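/- Let $E$ and $F$ be complex Banach spaces, let $B_E$ be the open unit ball of $E$, let $m\ge 0$ be an integer, and let $P\colon E\to F$ be a continuous $m$-homogeneous polynomial, i.e. $P(x)=A(x,\dots,x)$ for all $x\in E$, for some continuous $m$-linear map $A\colon E^m\to F$. For $L\subset F$ and $\varepsilon>0$ let $N(L,\varepsilon)\in\mathbb N\cup\{\infty\}$ be the least number of open balls of radius $\varepsilon$ with centres in $F$ that cover $L$ (with $N(L,\varepsilon)=\infty$ if no finite number suffices), and let $$\underline{\dim}_B L=\liminf_{\varepsilon\to0^+}\frac{\log N(L,\varepsilon)}{-\log\varepsilon}\in[0,\infty]\qquad(L\neq\emptyset)$$ be its lower box dimension, where $\log\infty=\infty$. Then the linear span of $P(B_E)$ is infinite-dimensional if and only if $\underline{\dim}_B P(B_E)=\infty$. -/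

import Mathlib

open Filter Topology
open scoped ENNReal

/-- The covering number `N(L, ε)`: the least `n` such that `L` is contained in a union of `n` open
balls of radius `ε` with centres in `X`, with value `⊤` when no such `n` exists. -/
noncomputable def openBallCoveringNumber {X : Type*} [MetricSpace X] (L : Set X) (ε : ℝ) : ℕ∞ :=
  ⨅ (n : ℕ) (_ : ∃ x : Fin n → X, L ⊆ ⋃ i, Metric.ball (x i) ε), (n : ℕ∞)

/-- The lower box counting dimension `liminf_{ε → 0⁺} log N(L, ε) / (-log ε)`, as an extended real.
It uses the extended logarithm, with `log ∞ = ∞`, so that a set which is not totally bounded has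
lower box dimension `⊤`. -/
noncomputable def lowerBoxDim {X : Type*} [MetricSpace X] (L : Set X) : EReal :=
  liminf (fun ε : ℝ =>
    ENNReal.log ((openBallCoveringNumber L ε : ℕ∞) : ℝ≥0∞) / ((-Real.log ε : ℝ) : EReal)) (𝓝[>] 0)

/-- `P` is a (continuous) `m`-homogeneous polynomial: the restriction to the diagonal of a
continuous `m`-linear map. -/
def IsHomogeneousPolynomial {E F : Type*} [NormedAddCommGroup E] [NormedSpace ℂ E]
    [NormedAddCommGroup F] [NormedSpace ℂ F] (m : ℕ) (P : E → F) : Prop :=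
  ∃ A : ContinuousMultilinearMap ℂ (fun _ : Fin m => E) F, ∀ x : E, P x = A (fun _ => x)

/-! ### Box dimension from covering estimates -/

section BoxDimension

variable {X : Type*} [MetricSpace X]

/-! A bounded set with finite-dimensional span has covering numbers polynomial in `ε⁻¹`, hence
finite dimension. Conversely, if the derivative of `P` has rank at least `r` at a point of the ball,
some projection of `P(B_E)` to `ℂʳ` contains a ball, and comparing volumes gives lower box dimension
at least `r`. So finite dimension bounds the rank. At a point `a` of maximal rank, witnessed by
directions `v`, the constant rank theorem shows that `P` near `a` takes only values it takes on `a +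
span v`. Those lie in a finite-dimensional `S` because `P` is polynomial, and the identity theorem
applied to `P` modulo `S` gives `P x ∈ S` for every `x`. -/

lemma openBallCoveringNumber_le_card {L : Set X} {ε : ℝ} (t : Finset X)
    (h : L ⊆ ⋃ c ∈ t, Metric.ball c ε) : openBallCoveringNumber L ε ≤ t.card := by
  refine iInf₂_le t.card ⟨fun i => (t.equivFin.symm i : X), fun x hx => ?_⟩
  obtain ⟨c, hc, hxc⟩ := Set.mem_iUnion₂.1 (h hx)
  exact Set.mem_iUnion.2 ⟨t.equivFin ⟨c, hc⟩, by simpa using hxc⟩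

lemma natCast_le_lowerBoxDim {L : Set X} {r : ℕ}
    (h : ∀ᶠ ε : ℝ in 𝓝[>] 0,
      ENNReal.ofReal (ε⁻¹ ^ r) ≤ ((openBallCoveringNumber L ε : ℕ∞) : ℝ≥0∞)) :
    (r : EReal) ≤ lowerBoxDim L := by
  refine le_liminf_of_le (by isBoundedDefault) ?_
  filter_upwards [h, Ioo_mem_nhdsGT (zero_lt_one' ℝ)] with ε hε hε1
  have hlog : 0 < -Real.log ε := neg_pos.2 (Real.log_neg hε1.1 hε1.2)
  rw [EReal.le_div_iff_mul_le (by exact_mod_cast hlog) (EReal.coe_ne_top _)]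
  refine le_trans (le_of_eq ?_) (ENNReal.log_monotone hε)
  rw [ENNReal.log_ofReal_of_pos (by have := hε1.1; positivity), Real.log_pow, Real.log_inv]
  norm_cast

lemma lowerBoxDim_le_natCast {L : Set X} {k : ℕ}
    (h : ∀ᶠ ε : ℝ in 𝓝[>] 0,
      ((openBallCoveringNumber L ε : ℕ∞) : ℝ≥0∞) ≤ ENNReal.ofReal (ε⁻¹ ^ k)) :
    lowerBoxDim L ≤ (k : EReal) := by
  refine liminf_le_of_frequently_le' (Eventually.frequently ?_)
  filter_upwards [h, Ioo_mem_nhdsGT (zero_lt_one' ℝ)] with ε hε hε1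
  have hlog : 0 < -Real.log ε := neg_pos.2 (Real.log_neg hε1.1 hε1.2)
  rw [EReal.div_le_iff_le_mul (by exact_mod_cast hlog) (EReal.coe_ne_top _)]
  refine le_trans (ENNReal.log_monotone hε) (le_of_eq ?_)
  rw [ENNReal.log_ofReal_of_pos (by have := hε1.1; positivity), Real.log_pow, Real.log_inv,
    mul_comm]
  norm_cast

end BoxDimension

/-- Balls of a finite-dimensional space are covered by boundedly many balls of half the radius;
iterating gives a polynomial bound on covering numbers. -/
lemma exists_card_le_pow_cover_ball (V : Type*) [NormedAddCommGroup V] [NormedSpace ℂ V]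
    [FiniteDimensional ℂ V] :
    ∃ M : ℕ, ∀ (j : ℕ) (ρ : ℝ), 0 < ρ → ∃ t : Finset V, t.card ≤ M ^ j ∧
      Metric.ball (0 : V) ρ ⊆ ⋃ c ∈ t, Metric.ball c (ρ / 2 ^ j) := by
  classical
  have : ProperSpace V := FiniteDimensional.proper ℂ V
  obtain ⟨t₀, -, ht₀, hcov⟩ := (isCompact_closedBall (0 : V) 1).finite_cover_balls
    (e := 1 / 2) (by norm_num)
  lift t₀ to Finset V using ht₀
  refine ⟨t₀.card, fun j ρ hρ => ?_⟩
  induction j with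
  | zero => exact ⟨{0}, by simp, by simp⟩
  | succ j ih =>
    obtain ⟨t, htc, ht⟩ := ih
    set δ : ℝ := ρ / 2 ^ j with hδ
    have hδ0 : 0 < δ := by positivity
    refine ⟨Finset.image₂ (fun c s => c + (δ : ℂ) • s) t t₀, ?_, fun x hx => ?_⟩
    · exact (Finset.card_image₂_le _ _ _).trans (by rw [pow_succ]; gcongr)
    · obtain ⟨c, hc, hxc⟩ := Set.mem_iUnion₂.1 (ht hx)
      have hδC : (δ : ℂ) ≠ 0 := by exact_mod_cast hδ0.ne'
      have hmem : (δ : ℂ)⁻¹ • (x - c) ∈ Metric.closedBall (0 : V) 1 := by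
        rw [mem_closedBall_zero_iff, norm_smul, norm_inv, Complex.norm_real, Real.norm_eq_abs,
          abs_of_pos hδ0, inv_mul_le_iff₀ hδ0, mul_one, ← dist_eq_norm]
        exact (Metric.mem_ball.1 hxc).le
      obtain ⟨s, hs, hxs⟩ := Set.mem_iUnion₂.1 (hcov hmem)
      refine Set.mem_iUnion₂.2 ⟨c + (δ : ℂ) • s, Finset.mem_image₂_of_mem hc hs, ?_⟩
      have hx' : x - (c + (δ : ℂ) • s) = (δ : ℂ) • ((δ : ℂ)⁻¹ • (x - c) - s) := by
        rw [smul_sub, smul_inv_smul₀ hδC]; abel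
      rw [Metric.mem_ball, dist_eq_norm, hx', norm_smul, Complex.norm_real, Real.norm_eq_abs,
        abs_of_pos hδ0]
      rw [Metric.mem_ball, dist_eq_norm] at hxs
      calc δ * _ < δ * (1 / 2) := by gcongr
        _ = ρ / 2 ^ (j + 1) := by rw [hδ, pow_succ]; field_simp

lemma lowerBoxDim_ne_top_of_finiteDimensional_span {F : Type*} [NormedAddCommGroup F]
    [NormedSpace ℂ F] {L : Set F} (hL : Bornology.IsBounded L)
    [FiniteDimensional ℂ (Submodule.span ℂ L)] : lowerBoxDim L ≠ ⊤ := by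
  classical
  obtain ⟨M, hM⟩ := exists_card_le_pow_cover_ball (Submodule.span ℂ L)
  obtain ⟨R, hR1, hR⟩ := hL.subset_ball_lt 1 0
  obtain ⟨q, hq⟩ : ∃ q : ℕ, M ≤ 2 ^ q := ⟨M, M.lt_two_pow_self.le⟩
  -- Halving `n + 1` times costs `M ^ (n + 1) ≤ (2R/ε) ^ q` balls; doubling the exponent absorbs `2R
  -- ≤ ε⁻¹`.
  suffices h : lowerBoxDim L ≤ ((2 * q : ℕ) : EReal) from
    (h.trans_lt (EReal.coe_lt_top (2 * q : ℕ))).ne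
  refine lowerBoxDim_le_natCast ?_
  have hpos : (0 : ℝ) < (2 * R)⁻¹ := by positivity
  filter_upwards [Ioo_mem_nhdsGT hpos] with ε hε
  have hε0 := hε.1
  have h2R : 2 * R ≤ ε⁻¹ := (le_inv_comm₀ hε0 (by positivity)).1 hε.2.le
  obtain ⟨n, hn, hn'⟩ := exists_nat_pow_near (x := R * ε⁻¹) (y := 2) (by nlinarith) one_lt_two
  obtain ⟨t, htc, ht⟩ := hM (n + 1) R (by positivity)
  have hsub : L ⊆ ⋃ c ∈ t.image (Subtype.val), Metric.ball c ε := by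
    intro x hx
    have hx0 : (⟨x, Submodule.subset_span hx⟩ : Submodule.span ℂ L) ∈ Metric.ball 0 R := by
      simpa using hR hx
    obtain ⟨c, hc, hxc⟩ := Set.mem_iUnion₂.1 (ht hx0)
    refine Set.mem_iUnion₂.2 ⟨c, Finset.mem_image_of_mem _ hc, ?_⟩
    have hle : R / 2 ^ (n + 1) ≤ ε := by
      rw [div_le_iff₀ (by positivity), mul_comm, ← div_le_iff₀ hε0, div_eq_mul_inv]
      exact hn'.le
    exact Metric.ball_subset_ball hle hxc
  have hN : openBallCoveringNumber L ε ≤ ((M ^ (n + 1) : ℕ) : ℕ∞) :=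
    (openBallCoveringNumber_le_card _ hsub).trans
      (by exact_mod_cast Finset.card_image_le.trans htc)
  have hN' : ((openBallCoveringNumber L ε : ℕ∞) : ℝ≥0∞) ≤ ((M ^ (n + 1) : ℕ) : ℝ≥0∞) := by
    exact_mod_cast hN
  refine hN'.trans ?_
  rw [← ENNReal.ofReal_natCast]
  refine ENNReal.ofReal_le_ofReal ?_
  calc ((M ^ (n + 1) : ℕ) : ℝ) ≤ (((2 ^ q) ^ (n + 1) : ℕ) : ℝ) := by gcongr
    _ = (2 ^ n * 2) ^ q := by push_cast; rw [← pow_mul, mul_comm q, pow_mul, pow_succ]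
    _ ≤ (ε⁻¹ * R * 2) ^ q := by rw [mul_comm ε⁻¹]; gcongr
    _ ≤ (ε⁻¹ ^ 2) ^ q := by
      gcongr
      rw [sq, mul_assoc, mul_comm R]
      gcongr
    _ = ε⁻¹ ^ (2 * q) := (pow_mul _ _ _).symm

/-- If a continuous linear image of `L` in `ℂʳ` contains a ball, then `L` has lower box dimension
at least `r`. -/
lemma natCast_le_lowerBoxDim_of_ball_subset_image {F : Type*} [NormedAddCommGroup F]
    [NormedSpace ℂ F] {L : Set F} {r : ℕ} (q : F →L[ℂ] (Fin r → ℂ)) {w : Fin r → ℂ} {ρ : ℝ}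
    (hρ : 0 < ρ) (h : Metric.ball w ρ ⊆ q '' L) : (r : EReal) ≤ lowerBoxDim L := by
  refine natCast_le_lowerBoxDim ?_
  set C : ℝ := ‖q‖ + 1
  have hC : 0 < C := by positivity
  -- The real dimension of `ℂʳ` is `2r`, so volumes give `(ρ/(Cε)) ^ (2r)`. For `ε` below this
  -- threshold, half the exponent absorbs `ρ/C`.
  have hpos : 0 < (ρ / C) ^ 2 := by positivity
  filter_upwards [Ioo_mem_nhdsGT hpos] with ε hε
  have hε0 := hε.1
  have hfin : Module.finrank ℝ (Fin r → ℂ) = r * 2 := by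
    simp [Module.finrank_pi_fintype, Complex.finrank_real_complex]
  obtain htop | htop := eq_or_ne (openBallCoveringNumber L ε) ⊤
  · simp [htop]
  have hle : ∀ n : ℕ, (∃ x : Fin n → F, L ⊆ ⋃ i, Metric.ball (x i) ε) → ε⁻¹ ^ r ≤ n := by
    rintro n ⟨x, hx⟩
    have hcov : Metric.ball w ρ ⊆ ⋃ i, Metric.ball (q (x i)) (C * ε) := by
      intro z hz
      obtain ⟨y, hy, rfl⟩ := h hz
      obtain ⟨i, hi⟩ := Set.mem_iUnion.1 (hx hy)
      refine Set.mem_iUnion.2 ⟨i, ?_⟩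
      rw [Metric.mem_ball, dist_eq_norm] at hi ⊢
      rw [← map_sub]
      calc ‖q (y - x i)‖ ≤ ‖q‖ * ‖y - x i‖ := q.le_opNorm _
        _ ≤ ‖q‖ * ε := by gcongr
        _ < C * ε := by gcongr; exact lt_add_one _
    let μ : MeasureTheory.Measure (Fin r → ℂ) := MeasureTheory.volume
    have hvol : μ (Metric.ball w ρ) ≤ n * μ (Metric.ball 0 (C * ε)) := by
      calc μ (Metric.ball w ρ) ≤ ∑ i, μ (Metric.ball (q (x i)) (C * ε)) :=
            (MeasureTheory.measure_mono hcov).trans (MeasureTheory.measure_iUnion_fintype_le _ _)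
        _ = n * μ (Metric.ball 0 (C * ε)) := by
            simp [μ, MeasureTheory.Measure.addHaar_ball_center]
    rw [MeasureTheory.Measure.addHaar_ball_of_pos μ _ hρ,
      MeasureTheory.Measure.addHaar_ball_of_pos μ _ (by positivity : 0 < C * ε), ← mul_assoc,
      ENNReal.mul_le_mul_iff_left (Metric.measure_ball_pos μ _ one_pos).ne'
        MeasureTheory.measure_ball_lt_top.ne, ← ENNReal.ofReal_natCast,
      ← ENNReal.ofReal_mul (by positivity), ENNReal.ofReal_le_ofReal_iff (by positivity),
      hfin] at hvol
    calc ε⁻¹ ^ r ≤ ((ρ / (C * ε)) ^ 2) ^ r := by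
          gcongr
          rw [inv_le_iff_one_le_mul₀ hε0]
          have := (one_le_div hε0).2 hε.2.le
          calc (1 : ℝ) ≤ (ρ / C) ^ 2 / ε := this
            _ = _ := by field_simp
      _ = ρ ^ (r * 2) / (C * ε) ^ (r * 2) := by rw [← pow_mul, mul_comm 2 r, div_pow]
      _ ≤ n := by rwa [div_le_iff₀ (by positivity)]
  obtain ⟨N, hN⟩ := ENat.ne_top_iff_exists.1 htop
  have hNmem : ε⁻¹ ^ r ≤ N := by
    have hge : ((⌈ε⁻¹ ^ r⌉₊ : ℕ) : ℕ∞) ≤ openBallCoveringNumber L ε :=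
      le_iInf₂ fun n hn => by exact_mod_cast Nat.ceil_le.2 (hle n hn)
    rw [← hN] at hge
    exact Nat.ceil_le.1 (by exact_mod_cast hge)
  rw [← hN]
  simpa using ENNReal.ofReal_le_ofReal hNmem

/-! ### Constant rank theorem -/

section ConstantRank

variable {E F : Type*} [NormedAddCommGroup E] [NormedSpace ℂ E]
    [NormedAddCommGroup F] [NormedSpace ℂ F]

/-- Hahn–Banach extends the coordinate functionals from the span of `u`. -/
lemma LinearIndependent.exists_continuousLinearMap_apply_eq_single {r : ℕ} {u : Fin r → F}
    (hu : LinearIndependent ℂ u) :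
    ∃ π : F →L[ℂ] (Fin r → ℂ), ∀ i, π (u i) = Pi.single i 1 := by
  have := FiniteDimensional.span_of_finite ℂ (Set.finite_range u)
  have h : ∀ j, ∃ g : StrongDual ℂ F, ∀ i, g (u i) = Pi.single (M := fun _ => ℂ) i 1 j := by
    intro j
    obtain ⟨g, hg, -⟩ := exists_extension_norm_eq (Submodule.span ℂ (Set.range u))
      (((Finsupp.lapply j).comp hu.repr).toContinuousLinearMap)
    refine ⟨g, fun i => ?_⟩
    have := hg ⟨u i, Submodule.subset_span (Set.mem_range_self i)⟩
    rw [this]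
    simp [hu.repr_eq_single i, Finsupp.single_apply, Pi.single_apply, eq_comm]
  choose g hg using h
  exact ⟨ContinuousLinearMap.pi g, fun i => funext fun j => hg j i⟩

/-- A linear map of rank at most `r` which has rank `r` after composition with `π` vanishes
wherever its composition with `π` does. -/
lemma apply_eq_zero_of_not_linearIndependent_succ {r : ℕ} {G : Type*} [AddCommGroup G] [Module ℂ G]
    {D : E →ₗ[ℂ] F} {π : F →ₗ[ℂ] G} {v : Fin r → E}
    (hv : LinearIndependent ℂ fun i => π (D (v i)))
    (hD : ∀ w : Fin (r + 1) → E, ¬ LinearIndependent ℂ fun i => D (w i))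
    {h : E} (hh : π (D h) = 0) : D h = 0 := by
  by_contra hne
  apply hD (Fin.cons h v)
  have hDv : LinearIndependent ℂ fun i => D (v i) := LinearIndependent.of_comp π hv
  have hcons : (fun i => D ((Fin.cons h v : Fin (r + 1) → E) i)) =
      (Fin.cons (D h) (fun i => D (v i)) : Fin (r + 1) → F) := by
    funext i
    refine Fin.cases ?_ (fun j => ?_) i <;> simp
  rw [hcons, linearIndependent_finCons]
  refine ⟨hDv, fun hmem => hne ?_⟩
  obtain ⟨c, hc⟩ := (Submodule.mem_span_range_iff_exists_fun ℂ).1 hmem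
  have h0 : ∑ i, c i • π (D (v i)) = 0 := by rw [← hh, ← hc]; simp
  rw [← hc]
  exact Finset.sum_eq_zero fun i _ => by
    rw [Fintype.linearIndependent_iff.1 hv c h0 i, zero_smul]

/-- A form of the constant rank theorem: if the derivative of `f` has rank `r` at `a`, witnessed by
the directions `v`, and rank at most `r` nearby, then all values of `f` near `a` are attained on
the affine subspace `a + span v`. -/
lemma eventually_exists_sub_mem_span_of_rank_le [CompleteSpace E] {f : E → F}
    (hf : ContDiff ℂ 1 f) {a : E} {r : ℕ} {v : Fin r → E}
    (hv : LinearIndependent ℂ fun i => fderiv ℂ f a (v i))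
    (hmax : ∀ᶠ x in 𝓝 a, ∀ w : Fin (r + 1) → E,
      ¬ LinearIndependent ℂ fun i => fderiv ℂ f x (w i)) :
    ∀ᶠ x in 𝓝 a, ∃ y, y - a ∈ Submodule.span ℂ (Set.range v) ∧ f x = f y := by
  obtain ⟨π, hπ⟩ := hv.exists_continuousLinearMap_apply_eq_single
  have hdf : Differentiable ℂ f := hf.differentiable one_ne_zero
  let T : (Fin r → ℂ) →L[ℂ] E := (Fintype.linearCombination ℂ v).toContinuousLinearMap
  have hTmem : ∀ c, T c ∈ Submodule.span ℂ (Set.range v) := fun c =>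
    (Submodule.mem_span_range_iff_exists_fun ℂ).2 ⟨c, rfl⟩
  let G : E →L[ℂ] (Fin r → ℂ) := π ∘L fderiv ℂ f a
  have hGT : ∀ c, G (T c) = c := fun c => by
    simp [G, T, Fintype.linearCombination_apply, hπ, ← pi_eq_sum_univ']
  -- `Φ` straightens `π ∘ f`: its derivative at `a` is the identity, `G ∘ Φ = π ∘ f`, and it moves
  -- points only along `span v`.
  let Φ : E → E := fun x => x - T (G x) + T (π (f x))
  have hΦc : ContDiff ℂ 1 Φ := by fun_prop
  have hΦ' : HasFDerivAt Φ ((ContinuousLinearEquiv.refl ℂ E : E ≃L[ℂ] E) : E →L[ℂ] E) a := by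
    have h1 : HasFDerivAt Φ
        (ContinuousLinearMap.id ℂ E - T ∘L G + T ∘L (π ∘L fderiv ℂ f a)) a :=
      ((hasFDerivAt_id a).sub (T ∘L G).hasFDerivAt).add
        (T.hasFDerivAt.comp a (π.hasFDerivAt.comp a (hdf a).hasFDerivAt))
    convert h1 using 1
    simp [G]
  have hGΦ : ∀ x, G (Φ x) = π (f x) := fun x => by simp [Φ, hGT]
  have hs := hΦc.contDiffAt.hasStrictFDerivAt' hΦ' one_ne_zero
  let Ψ : E → E := hΦc.contDiffAt.localInverse hΦ' one_ne_zero
  have hΨa : Ψ (Φ a) = a := hΦc.contDiffAt.localInverse_apply_image hΦ' one_ne_zero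
  have hΨc : ContDiffAt ℂ 1 Ψ (Φ a) := hΦc.contDiffAt.to_localInverse hΦ' one_ne_zero
  have hΨt : Tendsto Ψ (𝓝 (Φ a)) (𝓝 a) := by
    have := hΨc.continuousAt.tendsto
    rwa [hΨa] at this
  have hvnear : ∀ᶠ x in 𝓝 a, LinearIndependent ℂ fun i => π (fderiv ℂ f x (v i)) := by
    have hcont : Continuous fun x => fun i => π (fderiv ℂ f x (v i)) := by
      have := hf.continuous_fderiv one_ne_zero
      fun_prop
    refine hcont.continuousAt.eventually (LinearIndependent.eventually ?_)
    simp_rw [hπ]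
    exact Pi.linearIndependent_single_one (Fin r) ℂ
  have hΨd : ∀ᶠ y in 𝓝 (Φ a), DifferentiableAt ℂ Ψ y :=
    (hΨc.eventually (by simp)).mono fun y hy => hy.differentiableAt one_ne_zero
  obtain ⟨δ, hδ, hball⟩ := Metric.eventually_nhds_iff_ball.1
    ((hΨd.and hs.eventually_right_inverse).and ((hΨt.eventually hvnear).and (hΨt.eventually hmax)))
  -- Since `π ∘ f ∘ Ψ = G` here, the rank bound makes `f ∘ Ψ` stationary along `ker G`.
  have hderiv : ∀ y ∈ Metric.ball (Φ a) δ, ∀ h, G h = 0 →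
      fderiv ℂ f (Ψ y) (fderiv ℂ Ψ y h) = 0 := by
    intro y hy h hh
    obtain ⟨⟨hyd, -⟩, hyv, hym⟩ := hball y hy
    refine apply_eq_zero_of_not_linearIndependent_succ (D := (fderiv ℂ f (Ψ y)).toLinearMap)
      (π := π.toLinearMap) hyv hym ?_
    have h1 : HasFDerivAt (fun z => π (f (Ψ z))) (π ∘L (fderiv ℂ f (Ψ y) ∘L fderiv ℂ Ψ y)) y :=
      π.hasFDerivAt.comp y ((hdf (Ψ y)).hasFDerivAt.comp y hyd.hasFDerivAt)
    have h2 : HasFDerivAt (fun z => π (f (Ψ z))) G y := by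
      refine G.hasFDerivAt.congr_of_eventuallyEq ?_
      filter_upwards [Metric.isOpen_ball.mem_nhds hy] with z hz
      rw [← hGΦ]
      exact congrArg G (hball z hz).1.2
    have h3 := DFunLike.congr_fun (h1.unique h2) h
    rw [hh] at h3
    exact h3
  have hconst : ∀ y ∈ Metric.ball (Φ a) δ, ∀ h, G h = 0 → y + h ∈ Metric.ball (Φ a) δ →
      f (Ψ y) = f (Ψ (y + h)) := by
    intro y hy h hh hyh
    let ℓ : ℂ →L[ℂ] E := ContinuousLinearMap.toSpanSingleton ℂ h
    let s : Set ℂ := (fun t : ℂ => y + ℓ t) ⁻¹' Metric.ball (Φ a) δ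
    have hso : IsOpen s := Metric.isOpen_ball.preimage (by fun_prop)
    have hsc : Convex ℝ s :=
      ((convex_ball (Φ a) δ).translate_preimage_right y).linear_preimage
        (ℓ.toLinearMap.restrictScalars ℝ)
    have hd : ∀ t ∈ s, HasDerivAt (fun t : ℂ => f (Ψ (y + ℓ t))) 0 t := by
      intro t ht
      have h1 : HasDerivAt (fun t : ℂ => y + ℓ t) h t := by
        simpa [ℓ] using (ℓ.hasDerivAt (x := t)).const_add y
      have h2 := (hdf (Ψ (y + ℓ t))).hasFDerivAt.comp_hasDerivAt t
        ((hball _ ht).1.1.hasFDerivAt.comp_hasDerivAt t h1)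
      rwa [hderiv _ ht h hh] at h2
    have := hso.is_const_of_deriv_eq_zero hsc.isPreconnected
      (fun t ht => (hd t ht).differentiableAt.differentiableWithinAt)
      (fun t ht => (hd t ht).deriv) (x := 0) (y := 1) (by simpa [s, ℓ] using hy)
      (by simpa [s, ℓ] using hyh)
    simpa [ℓ] using this
  have hΦcont : ContinuousAt Φ a := hΦc.continuous.continuousAt
  have hproj : ContinuousAt (fun x => Φ a + T (G (Φ x - Φ a))) a := by fun_prop
  have hprojt : Tendsto (fun x => Φ a + T (G (Φ x - Φ a))) (𝓝 a) (𝓝 (Φ a)) := by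
    simpa using hproj.tendsto
  filter_upwards [hs.eventually_left_inverse, hΦcont.eventually (Metric.ball_mem_nhds _ hδ),
    hprojt.eventually (Metric.ball_mem_nhds _ hδ)] with x hx hx1 hx2
  -- Slide `Φ x` along `ker G` into `Φ a + span v`; this leaves `f ∘ Ψ` unchanged.
  set y' := Φ a + T (G (Φ x - Φ a)) with hy'
  refine ⟨Ψ y', ?_, ?_⟩
  · have h1 : Φ (Ψ y') = y' := (hball y' hx2).1.2
    have h2 : Ψ y' - a = T (G (Ψ y') - π (f (Ψ y')) - G a + π (f a) + G (Φ x - Φ a)) := by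
      have h3 : Ψ y' - T (G (Ψ y')) + T (π (f (Ψ y'))) =
        a - T (G a) + T (π (f a)) + T (G (Φ x - Φ a)) := h1
      simp only [map_add, map_sub] at h3 ⊢
      rw [← sub_eq_zero] at h3 ⊢
      rw [← h3]
      abel
    rw [h2]
    exact hTmem _
  · have := hconst (Φ x) hx1 (y' - Φ x) (by simp [hy', hGT]) (by simpa using hx2)
    rw [add_sub_cancel] at this
    rw [← this]
    exact congrArg f (hx : Ψ (Φ x) = x).symm

end ConstantRank

/-! ### Homogeneous polynomials -/

section Polynomial

variable {E F : Type*} [NormedAddCommGroup E] [NormedSpace ℂ E]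
    [NormedAddCommGroup F] [NormedSpace ℂ F] {m : ℕ} {P : E → F}

lemma IsHomogeneousPolynomial.exists_finiteDimensional_apply_mem_of_mem_span
    (hP : IsHomogeneousPolynomial m P) {ι : Type*} [Finite ι] (b : ι → E) :
    ∃ S : Submodule ℂ F, FiniteDimensional ℂ S ∧
      ∀ x ∈ Submodule.span ℂ (Set.range b), P x ∈ S := by
  classical
  have := Fintype.ofFinite ι
  obtain ⟨A, hA⟩ := hP
  refine ⟨Submodule.span ℂ (Set.range fun σ : Fin m → ι => A fun i => b (σ i)),
    FiniteDimensional.span_of_finite ℂ (Set.finite_range _), fun x hx => ?_⟩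
  obtain ⟨c, rfl⟩ := (Submodule.mem_span_range_iff_exists_fun ℂ).1 hx
  rw [hA, A.map_sum (fun _ i => c i • b i)]
  refine Submodule.sum_mem _ fun σ _ => ?_
  rw [A.map_smul_univ (fun i => c (σ i)) fun i => b (σ i)]
  exact Submodule.smul_mem _ _ (Submodule.subset_span ⟨σ, rfl⟩)

lemma IsHomogeneousPolynomial.contDiff (hP : IsHomogeneousPolynomial m P) {n : WithTop ℕ∞} :
    ContDiff ℂ n P := by
  obtain ⟨A, hA⟩ := hP
  rw [funext hA]
  exact A.contDiff.comp (contDiff_pi.2 fun _ => contDiff_id)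

lemma IsHomogeneousPolynomial.isBounded_image_ball (hP : IsHomogeneousPolynomial m P) :
    Bornology.IsBounded (P '' Metric.ball 0 1) := by
  obtain ⟨A, hA⟩ := hP
  refine isBounded_iff_forall_norm_le.2 ⟨‖A‖, ?_⟩
  rintro _ ⟨x, hx, rfl⟩
  rw [hA]
  refine (A.le_opNorm _).trans (mul_le_of_le_one_right (norm_nonneg _) ?_)
  exact Finset.prod_le_one (fun _ _ => norm_nonneg _)
    fun _ _ => (mem_ball_zero_iff.1 hx).le

/-- Identity theorem in the quotient by the closed subspace `S`; smoothness `⊤` means analytic. -/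
lemma ContDiff.apply_mem_of_eventually_mem {f : E → F} (hf : ContDiff ℂ ⊤ f) {S : Submodule ℂ F}
    [FiniteDimensional ℂ S] {a : E} (h : ∀ᶠ x in 𝓝 a, f x ∈ S) (x : E) : f x ∈ S := by
  have : IsClosed (S : Set F) := S.closed_of_finiteDimensional
  have hq : AnalyticOnNhd ℂ (fun x => S.mkQL (f x)) Set.univ := fun y _ =>
    (S.mkQL.contDiff.comp hf).contDiffAt.analyticAt
  have h0 : (fun x => S.mkQL (f x)) = 0 := by
    refine hq.eq_of_eventuallyEq (z₀ := a) (fun y _ => analyticAt_const) ?_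
    filter_upwards [h] with y hy
    simpa using hy
  simpa using congrFun h0 x

lemma natCast_le_lowerBoxDim_image_of_linearIndependent_fderiv [CompleteSpace E] {f : E → F}
    (hf : ContDiff ℂ 1 f) {s : Set E} {a : E} (hs : s ∈ 𝓝 a) {r : ℕ} {v : Fin r → E}
    (hv : LinearIndependent ℂ fun i => fderiv ℂ f a (v i)) :
    (r : EReal) ≤ lowerBoxDim (f '' s) := by
  obtain ⟨π, hπ⟩ := hv.exists_continuousLinearMap_apply_eq_single
  have hg : HasStrictFDerivAt (fun x => π (f x)) (π ∘L fderiv ℂ f a) a :=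
    π.hasStrictFDerivAt.comp a (hf.contDiffAt.hasStrictFDerivAt one_ne_zero)
  have hsurj : (π ∘L fderiv ℂ f a).range = ⊤ := by
    refine LinearMap.range_eq_top.2 fun c => ⟨∑ i, c i • v i, ?_⟩
    simp [hπ, ← pi_eq_sum_univ']
  have hmem : (fun x => π (f x)) '' s ∈ 𝓝 (π (f a)) := by
    rw [← hg.map_nhds_eq_of_surj hsurj]
    exact image_mem_map hs
  obtain ⟨ρ, hρ, hsub⟩ := Metric.mem_nhds_iff.1 hmem
  refine natCast_le_lowerBoxDim_of_ball_subset_image π hρ (hsub.trans ?_)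
  rw [Set.image_image]

lemma IsHomogeneousPolynomial.finiteDimensional_span_of_lowerBoxDim_ne_top [CompleteSpace E]
    (hP : IsHomogeneousPolynomial m P) {s : Set E} (hs : IsOpen s) (hne : s.Nonempty)
    (hdim : lowerBoxDim (P '' s) ≠ ⊤) :
    FiniteDimensional ℂ (Submodule.span ℂ (P '' s)) := by
  classical
  let R : ℕ → Prop := fun r => ∃ a ∈ s, ∃ v : Fin r → E,
    LinearIndependent ℂ fun i => fderiv ℂ P a (v i)
  have hle : ∀ r, R r → (r : EReal) ≤ lowerBoxDim (P '' s) := fun r ⟨a, ha, v, hv⟩ =>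
    natCast_le_lowerBoxDim_image_of_linearIndependent_fderiv hP.contDiff (hs.mem_nhds ha) hv
  have hbdd : ∃ r, ¬ R r := by
    by_contra! hall
    refine hdim (EReal.eq_top_iff_forall_lt _ |>.2 fun y => ?_)
    obtain ⟨n, hn⟩ := exists_nat_gt y
    exact lt_of_lt_of_le (by exact_mod_cast hn) (hle n (hall n))
  have h0 : R 0 := hne.imp fun a ha => ⟨ha, Fin.elim0, linearIndependent_empty_type⟩
  -- The predecessor of the least unattained rank: `r` is attained in `s`, `r + 1` nowhere in `s`.
  obtain ⟨r, hr⟩ : ∃ r, Nat.find hbdd = r + 1 :=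
    Nat.exists_eq_succ_of_ne_zero fun h => (h ▸ Nat.find_spec hbdd) h0
  obtain ⟨a, ha, v, hv⟩ : R r := not_not.1 (Nat.find_min hbdd (by omega))
  have hmax : ∀ᶠ x in 𝓝 a, ∀ w : Fin (r + 1) → E,
      ¬ LinearIndependent ℂ fun i => fderiv ℂ P x (w i) := by
    filter_upwards [hs.mem_nhds ha] with x hx w hw
    exact (hr ▸ Nat.find_spec hbdd) ⟨x, hx, w, hw⟩
  -- Adjoining `a` to `v` puts the affine space `a + span v` inside a linear span.
  obtain ⟨S, hS, hSmem⟩ := hP.exists_finiteDimensional_apply_mem_of_mem_span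
    (Fin.cons a v : Fin (r + 1) → E)
  have hnear : ∀ᶠ x in 𝓝 a, P x ∈ S := by
    filter_upwards [eventually_exists_sub_mem_span_of_rank_le hP.contDiff hv hmax]
      with x ⟨y, hy, hxy⟩
    rw [hxy]
    refine hSmem y ?_
    rw [Fin.range_cons, ← sub_add_cancel y a]
    exact add_mem (Submodule.span_mono (Set.subset_insert _ _) hy)
      (Submodule.subset_span (Set.mem_insert _ _))
  refine Submodule.finiteDimensional_of_le (S₂ := S) (Submodule.span_le.2 ?_)
  rintro _ ⟨x, -, rfl⟩
  exact hP.contDiff.apply_mem_of_eventually_mem hnear x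

end Polynomial

theorem mainTheorem1 {E F : Type*} [NormedAddCommGroup E] [NormedSpace ℂ E] [CompleteSpace E]
    [NormedAddCommGroup F] [NormedSpace ℂ F] [CompleteSpace F]
    (m : ℕ) (P : E → F) (hP : IsHomogeneousPolynomial m P) :
    ¬ FiniteDimensional ℂ (Submodule.span ℂ (P '' Metric.ball (0 : E) 1)) ↔
      lowerBoxDim (P '' Metric.ball (0 : E) 1) = ⊤ := by
  refine ⟨fun h => ?_, fun h hfin => ?_⟩
  · by_contra hdim
    exact h (hP.finiteDimensional_span_of_lowerBoxDim_ne_top Metric.isOpen_ball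
      (Metric.nonempty_ball.2 one_pos) hdim)
  · exact lowerBoxDim_ne_top_of_finiteDimensional_span hP.isBounded_image_ball h
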